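/- **HetDAPAC system.** Let $\mathbb F$ be a finite field and let $N\ge D\ge 2$, $K\ge 1$. A user has independent attributes $\bm v^*=(v_1^*,\dots,v_N^*)$, each with $K$ possible values. For each of the $K^N$ attribute vectors $\bm v$ there is a message $W_{\bm v}\in\mathbb F^L$; the messages $\mathcal W=(W_{\bm v})$ are independent. There are $D$ dedicated servers and a central server $D+1$. Server $n\in[D]$ knows $v_n^*$ and $v^*_{[D+1:N]}$; server $D+1$ knows $v^*_{[D+1:N]}$. The database $\mathcal W^n$ of a server consists of the messages whose attribute vector agrees with $\bm v^*$ in the attributes that the server knows. The servers share common randomness $\mathcal S$, consisting of independent uniform symbols of $\mathbb F$, independent of $\mathcal W$ and $\bm v^*$ and unavailable to the user. From $\bm v^*$ and private randomness, independent of everything else, the user generates queries $Q_1,\dots,Q_{D+1}$; server $n$ returns an answer $A_n$ of a fixed number $d_n$ of symbols, a function of $Q_n$, $\mathcal W^n$, $\mathcal S$ and the attributes it knows. The scheme is *feasible* if, for every attribute vector $\bm v^*$ of the user, $I(Q_{[1:D+1]};\mathcal W)=0$, $H(A_n\mid Q_n,\mathcal W^n,\mathcal S)=0$ for all $n$, $H(W_{\bm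 v^*}\mid Q_{[1:D+1]},A_{[1:D+1]})=0$ (correctness) and $I(\mathcal W\setminus W_{\bm v^*};Q_{[1:D+1]},A_{[1:D+1]})=0$ (database secrecy), and if, for random $\bm v^*$, $I(Q_n;v^*_{[1:D]\setminus\{n\}}\mid \mathcal S,v^*_{[D+1:N]},v_n^*,\mathcal W)=0$ for $n\in[D]$ and $I(Q_{D+1};v^*_{[1:D]}\mid\mathcal S,v^*_{[D+1:N]},\mathcal W)=0$ (attribute privacy). Its rate is $R=L/\sum_{n=1}^{D+1} d_n$; if $d_1=\dots=d_D$, its load ratio is $\ell=d_1/d_{D+1}\in[0,\infty]$. Below, an *accessible* message is one with $v_{[D+1:N]}=v^*_{[D+1:N]}$, $\mathcal U(n,k)$ is the set of accessible messages with $v_n$ equal to the $k$-th value, and $k_n$ is the index of the value $v_n^*$. **Scheme 1** ($L=Db$). Messages are split into $D$ sub-packets of $b$ symbols. The user draws a uniform permutation $\pi_{\bm v}$ of $[D]$ for each accessible $W_{\bm v}$ and a uniform coefficient vector $h_{nk}$ over $\mathbb F$ for each $n\in[D]$, $k\in[K]$, all independent. Let $w_{nk}$ be the matrix whose rows are the sub-packets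 $W_{\bm v}(\pi_{\bm v}(n))$, $W_{\bm v}\in\mathcal U(n,k)$. The central server is sent all $h_{nk}$ and the sub-packet indices of all $w_{nk}$, and answers $h_{nk}^Tw_{nk}+s_{nk}$ for all $n,k$. Server $n\in[D]$ is sent $h_{nk_n}+e$, with $e$ the unit vector at the position of $W_{\bm v^*}$, and the indices of $w_{nk_n}$, and answers $(h_{nk_n}+e)^Tw_{nk_n}+s_{nk_n}$. Here the $s_{nk}$ are disjoint blocks of $b$ symbols of $\mathcal S$. **$(D,K)$ DAPAC scheme** ($L=\binom D2a$). Messages are split into $\binom D2$ sub-packets of $a$ symbols, indexed by the pairs $\{n,m\}\subset[D]$. The user draws, all independent, a uniform permutation $\pi_{\bm v}$ of the sub-packets for each accessible $W_{\bm v}$ and a uniform coefficient $g_{\{n,m\}}(\bm v)\in\mathbb F$ for each pair and each accessible $W_{\bm v}$. For every $m\in[D]\setminus\{n\}$ and $k\in[K]$, server $n\in[D]$ answers the linear combination of the sub-packets $W_{\bm v}(\pi_{\bm v}(\{n,m\}))$, $W_{\bm v}\in\mathcal U(n,k_n)\cap\mathcal U(m,k)$, with coefficients $g_{\{n,m\}}(\bm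 v)$, increased by $1$ for $\bm v=\bm v^*$ if $n>m$, plus $s_{nm}^{(k_n,k)}$; its query consists of these coefficients and sub-packet indices. Here the $s_{nm}^{(k,k')}=s_{mn}^{(k',k)}$ are disjoint blocks of $a$ symbols of $\mathcal S$. Nothing is asked of or downloaded from the central server. **Time-sharing.** For $a,b\ge 0$, not both $0$, apply the DAPAC scheme to $\binom D2a$ symbols of each message and Scheme 1 to the other $Db$ symbols, with independent private and common randomness; here $L=\binom D2a+Db$, and $\lambda=\binom D2a/L\in[0,1]$ is the fraction of the symbols served by the DAPAC scheme. **Statement.** (i) For all such $a,b$ and all laws of the attributes and of the messages, the time-sharing scheme is a feasible $(N,D,K)$ HetDAPAC scheme with equal download costs at all dedicated servers, and its rate and load ratio are $$R(\lambda)=\frac1{K(1+\lambda)+(1-\lambda)},\qquad \ell(\lambda)=\frac{2K\lambda+1-\lambda}{KD(1-\lambda)}\quad(\ell(1)=\infty).$$ (ii) Consequently the pair $(R(\lambda),\ell(\lambda))$ is attained exactly by such a scheme for every rational $\lambda\in[0,1]$, and it is a limit of attained pairs for every real $\lambda\in[0,1]$. (iii) One has $(R(0),\ell(0))=\left(\frac1{K+1},\frac1{KD}\right)$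 and $(R(1),\ell(1))=\left(\frac1{2K},\infty\right)$, and for $0\le\lambda<1$ $$R(\lambda)=\frac{1}{K+\frac{\ell(\lambda)K^2D+K}{\ell(\lambda)KD+2K-1}}.$$ As $\lambda$ runs over $[0,1]$, the pairs $(R(\lambda),\ell(\lambda))$ are exactly the points of this trade-off curve with $\frac1{KD}\le\ell<\infty$, together with the end point $\left(\frac1{2K},\infty\right)$; the right-hand side, as a function of $\ell$, tends to $\frac1{2K}$ as $\ell\to\infty$. -/

import Mathlib

open scoped ENNReal

namespace HetDAPAC

/-! ### Shannon quantities on a finite probability space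

`p : Ω → ℝ` is the probability mass function of a finite sample space `Ω`;
random variables are functions on `Ω`. -/

section Entropy

variable {Ω α β γ : Type*} [Fintype Ω]

open scoped Classical in
/-- `P(X = a)`. -/
noncomputable def prob (p : Ω → ℝ) (X : Ω → α) (a : α) : ℝ :=
  ∑ ω with X ω = a, p ω

open scoped Classical in
/-- The Shannon entropy `H(X) = - ∑ₐ P(X = a) log P(X = a)`, the sum being over the values of `X`. -/
noncomputable def entropy (p : Ω → ℝ) (X : Ω → α) : ℝ :=
  ∑ a ∈ Finset.univ.image X, Real.negMulLog (prob p X a)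

/-- `H(X | Y) = H(X, Y) - H(Y)`. -/
noncomputable def condEntropy (p : Ω → ℝ) (X : Ω → α) (Y : Ω → β) : ℝ :=
  entropy p (fun ω => (X ω, Y ω)) - entropy p Y

/-- `I(X; Y) = H(X) - H(X | Y)`. -/
noncomputable def mutualInfo (p : Ω → ℝ) (X : Ω → α) (Y : Ω → β) : ℝ :=
  entropy p X - condEntropy p X Y

/-- `I(X; Y | Z) = H(X | Z) - H(X | Y, Z)`. -/
noncomputable def condMutualInfo (p : Ω → ℝ) (X : Ω → α) (Y : Ω → β) (Z : Ω → γ) : ℝ :=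
  condEntropy p X Z - condEntropy p X (fun ω => (Y ω, Z ω))

end Entropy

/-! ### Attribute vectors -/

/-- Values of the `D` sensitive attributes; the alphabets are enumerated by `Fin K`. -/
abbrev Sens (D K : ℕ) : Type := Fin D → Fin K

/-- Values of the `N - D` public attributes. -/
abbrev Pub (N D K : ℕ) : Type := Fin (N - D) → Fin K

/-- Attribute vectors `v = (v_1, …, v_N)`, split as
`((v_1, …, v_D), (v_{D+1}, …, v_N))`. -/
abbrev Attr (N D K : ℕ) : Type := Sens D K × Pub N D K

/-- Values of all the sensitive attributes except the `n`-th one. -/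
abbrev Others (D K : ℕ) (n : Fin D) : Type := {i : Fin D // i ≠ n} → Fin K

/-- The sensitive attribute values other than the `n`-th. -/
def others {D K : ℕ} (n : Fin D) (x : Sens D K) : Others D K n := fun i => x i.1

/-- The sensitive attribute vector with `n`-th entry `k` and the other entries given by `z`. -/
def extend {D K : ℕ} (n : Fin D) (k : Fin K) (z : Others D K n) : Sens D K :=
  fun i => if h : i = n then k else z ⟨i, h⟩

/-! ### Schemes -/

/-- A message retrieval scheme for the `(N, D, K)` HetDAPAC system, with messages `ι → F`, i.e.
messages of `L = |ι|` symbols of the field `F`. There are `D` dedicated servers, indexed by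
`Fin D`, and one central server.

The queries are generated from the attribute vector and private randomness of the user only.
A dedicated server `n` has verified the value of attribute `n` and has been told the public
values; its answer is a function of these, of its query, of the messages in its database (those
whose attribute vector agrees with the user's in attribute `n` and in the public attributes,
indexed by the remaining sensitive values), and of the common randomness. Likewise the central
server, which knows only the public values, and whose database is indexed by all the sensitive
values. `AnsD n` and `AnsC` index the symbols downloaded from the servers. -/
structure Scheme (N D K : ℕ) (F ι : Type) where
  /-- the user's private randomness, and its law -/
  Rand : Type
  [fintypeRand : Fintype Rand]
  law : stdSimplex ℝ Rand
  /-- the index set of the common randomness symbols -/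
  Key : Type
  [fintypeKey : Fintype Key]
  [decEqKey : DecidableEq Key]
  QueryD : Fin D → Type
  QueryC : Type
  AnsD : Fin D → Type
  [fintypeAnsD : ∀ n, Fintype (AnsD n)]
  AnsC : Type
  [fintypeAnsC : Fintype AnsC]
  queryD : Attr N D K → Rand → (n : Fin D) → QueryD n
  queryC : Attr N D K → Rand → QueryC
  answerD : (n : Fin D) → Fin K → Pub N D K → QueryD n → (Others D K n → ι → F) →
    (Key → F) → AnsD n → F
  answerC : Pub N D K → QueryC → (Sens D K → ι → F) → (Key → F) → AnsC → F

attribute [instance] Scheme.fintypeRand Scheme.fintypeKey Scheme.decEqKey Scheme.fintypeAnsD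
  Scheme.fintypeAnsC

namespace Scheme

variable {N D K : ℕ} {F ι : Type} (Sc : Scheme N D K F ι)

/-- The sample space for a fixed attribute vector: the user's private randomness, the messages
`(W_v)_v`, and the common randomness `S`. -/
abbrev Omega : Type := Sc.Rand × (Attr N D K → ι → F) × (Sc.Key → F)

/-- The messages. -/
def msgs (ω : Sc.Omega) : Attr N D K → ι → F := ω.2.1

/-- The common randomness. -/
def common (ω : Sc.Omega) : Sc.Key → F := ω.2.2

/-- The database of dedicated server `n` when the user has attribute vector `v`. -/
def databaseD (v : Attr N D K) (n : Fin D) (ω : Sc.Omega) : Others D K n → ι → F :=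
  fun z => Sc.msgs ω (extend n (v.1 n) z, v.2)

/-- The database of the central server when the user has attribute vector `v`. -/
def databaseC (v : Attr N D K) (ω : Sc.Omega) : Sens D K → ι → F :=
  fun x => Sc.msgs ω (x, v.2)

/-- The query to dedicated server `n`, as a random variable. -/
def qD (v : Attr N D K) (n : Fin D) (ω : Sc.Omega) : Sc.QueryD n := Sc.queryD v ω.1 n

/-- The query to the central server, as a random variable. -/
def qC (v : Attr N D K) (ω : Sc.Omega) : Sc.QueryC := Sc.queryC v ω.1

/-- The answer of dedicated server `n`. -/
def aD (v : Attr N D K) (n : Fin D) (ω : Sc.Omega) : Sc.AnsD n → F :=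
  Sc.answerD n (v.1 n) v.2 (Sc.qD v n ω) (Sc.databaseD v n ω) (Sc.common ω)

/-- The answer of the central server. -/
def aC (v : Attr N D K) (ω : Sc.Omega) : Sc.AnsC → F :=
  Sc.answerC v.2 (Sc.qC v ω) (Sc.databaseC v ω) (Sc.common ω)

/-- All the queries. -/
def queries (v : Attr N D K) (ω : Sc.Omega) : (∀ n, Sc.QueryD n) × Sc.QueryC :=
  (fun n => Sc.qD v n ω, Sc.qC v ω)

/-- All the answers. -/
def answers (v : Attr N D K) (ω : Sc.Omega) : (∀ n, Sc.AnsD n → F) × (Sc.AnsC → F) :=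
  (fun n => Sc.aD v n ω, Sc.aC v ω)

section Feasibility

variable [Fintype F] [DecidableEq ι] [Fintype ι]

/-- The probability mass function on `Omega`: the user's randomness, the messages and the common
randomness are independent; the messages `W_v` are independent with laws `pW v`; the common
randomness symbols are independent and uniform on `F`. -/
noncomputable def mass (pW : Attr N D K → stdSimplex ℝ (ι → F)) (ω : Sc.Omega) : ℝ :=
  Sc.law ω.1 * (∏ v, pW v (Sc.msgs ω v)) * ((Fintype.card F : ℝ) ^ Fintype.card Sc.Key)⁻¹

/-- The probability mass function on pairs of an attribute vector and a point of `Omega`: the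
attributes are independent, with laws `pX i` and `pY j`, and independent of the rest. -/
noncomputable def jointMass (pX : Fin D → stdSimplex ℝ (Fin K))
    (pY : Fin (N - D) → stdSimplex ℝ (Fin K)) (pW : Attr N D K → stdSimplex ℝ (ι → F))
    (τ : Attr N D K × Sc.Omega) : ℝ :=
  (∏ i, pX i (τ.1.1 i)) * (∏ j, pY j (τ.1.2 j)) * Sc.mass pW τ.2

/-- A feasible scheme, relative to the laws of the attributes and of the messages. In the
privacy constraints the attribute vector is random; the others hold for every fixed attribute
vector `v` of the user. -/
structure Feasible (pX : Fin D → stdSimplex ℝ (Fin K))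
    (pY : Fin (N - D) → stdSimplex ℝ (Fin K)) (pW : Attr N D K → stdSimplex ℝ (ι → F)) :
    Prop where
  /-- The queries are generated without knowledge of the messages. -/
  queries_indep : ∀ v, mutualInfo (Sc.mass pW) (Sc.queries v) Sc.msgs = 0
  /-- Each answer is determined by the query, the database and the common randomness. -/
  answerD_determined : ∀ v n, condEntropy (Sc.mass pW) (Sc.aD v n)
    (fun ω => (Sc.qD v n ω, Sc.databaseD v n ω, Sc.common ω)) = 0
  answerC_determined : ∀ v, condEntropy (Sc.mass pW) (Sc.aC v)
    (fun ω => (Sc.qC v ω, Sc.databaseC v ω, Sc.common ω)) = 0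
  /-- Correctness: the designated message is recovered from the queries and answers. -/
  correctness : ∀ v, condEntropy (Sc.mass pW) (fun ω => Sc.msgs ω v)
    (fun ω => (Sc.queries v ω, Sc.answers v ω)) = 0
  /-- Attribute privacy at dedicated server `n`. -/
  privacyD : ∀ n, condMutualInfo (Sc.jointMass pX pY pW)
    (fun τ => Sc.qD τ.1 n τ.2) (fun τ => others n τ.1.1)
    (fun τ => (Sc.common τ.2, τ.1.2, τ.1.1 n, Sc.msgs τ.2)) = 0
  /-- Attribute privacy at the central server. -/
  privacyC : condMutualInfo (Sc.jointMass pX pY pW)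
    (fun τ => Sc.qC τ.1 τ.2) (fun τ => τ.1.1)
    (fun τ => (Sc.common τ.2, τ.1.2, Sc.msgs τ.2)) = 0
  /-- Database secrecy: the user learns nothing about the other messages. -/
  secrecy : ∀ v, mutualInfo (Sc.mass pW)
    (fun ω => fun w : {w : Attr N D K // w ≠ v} => Sc.msgs ω w.1)
    (fun ω => (Sc.queries v ω, Sc.answers v ω)) = 0

end Feasibility

/-- The rate: message length over the total number of downloaded symbols. -/
noncomputable def rate [Fintype ι] : ℝ :=
  (Fintype.card ι : ℝ) /
    ((∑ n, (Fintype.card (Sc.AnsD n) : ℝ)) + (Fintype.card Sc.AnsC : ℝ))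

/-- The scheme has load ratio `ℓ ∈ [0, ∞]`: for every dedicated server, the number of symbols
downloaded from it over the number downloaded from the central server is `ℓ`. In particular
the download cost is the same for all dedicated servers when `ℓ ≠ 0, ∞`. -/
def HasLoadRatio (l : ℝ≥0∞) : Prop :=
  ∀ n, (Fintype.card (Sc.AnsD n) : ℝ≥0∞) / (Fintype.card Sc.AnsC : ℝ≥0∞) = l

/-- The download costs of all dedicated servers are equal. -/
def Symmetric : Prop :=
  ∀ n m, Fintype.card (Sc.AnsD n) = Fintype.card (Sc.AnsD m)

end Scheme

/-! ### Time-sharing -/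

/-- Time-sharing: the scheme `A` is applied to the symbols of each message indexed by `ι₁` and the
scheme `B` to those indexed by `ι₂`, with independent private and common randomness. -/
noncomputable def timeShare {N D K : ℕ} {F ι₁ ι₂ : Type}
    (A : Scheme N D K F ι₁) (B : Scheme N D K F ι₂) : Scheme N D K F (ι₁ ⊕ ι₂) where
  Rand := A.Rand × B.Rand
  law := ⟨fun u => A.law u.1 * B.law u.2,
    fun u => mul_nonneg (A.law.2.1 u.1) (B.law.2.1 u.2), by
      have hA : ∑ u, A.law u = 1 := A.law.2.2
      have hB : ∑ u, B.law u = 1 := B.law.2.2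
      rw [Fintype.sum_prod_type]
      simp only [← Finset.mul_sum, hB, mul_one, hA]⟩
  Key := A.Key ⊕ B.Key
  QueryD := fun n => A.QueryD n × B.QueryD n
  QueryC := A.QueryC × B.QueryC
  AnsD := fun n => A.AnsD n ⊕ B.AnsD n
  AnsC := A.AnsC ⊕ B.AnsC
  queryD := fun v u n => (A.queryD v u.1 n, B.queryD v u.2 n)
  queryC := fun v u => (A.queryC v u.1, B.queryC v u.2)
  answerD := fun n k y q W s => Sum.elim
    (A.answerD n k y q.1 (fun z i => W z (Sum.inl i)) (fun j => s (Sum.inl j)))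
    (B.answerD n k y q.2 (fun z i => W z (Sum.inr i)) (fun j => s (Sum.inr j)))
  answerC := fun y q W s => Sum.elim
    (A.answerC y q.1 (fun x i => W x (Sum.inl i)) (fun j => s (Sum.inl j)))
    (B.answerC y q.2 (fun x i => W x (Sum.inr i)) (fun j => s (Sum.inr j)))

/-! ### Scheme 1 -/

/-- Scheme 1, with `D` sub-packets of `b` symbols each; `(i, t) : Fin D × Fin b` is the `t`-th
symbol of sub-packet `i`.

The user draws a uniform permutation `π_x` of the `D` sub-packets for each accessible message
(these are indexed by the sensitive values `x`) and uniform coefficients `h n x`; the entries of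
`h n` at the `x` with `x n = k` form the coefficient vector `h_{nk}`, and sub-packet
`π_x(n)` of the message `x` enters the message group `w_{nk}`, `k = x n`.
The central server receives all of these, and answers
`h_{nk}ᵀ w_{nk} + s_{nk}` for all `n`, `k`. Dedicated server `n` receives the group
`w_{n k_n}` and the vector `h_{n k_n} + e`, where `e` is the unit vector at the position
of the designated message, and answers with this combination plus `s_{n k_n}`. -/
noncomputable def scheme1 (N D K : ℕ) (F : Type) [Field F] [Fintype F] (b : ℕ) :
    Scheme N D K F (Fin D × Fin b) where
  Rand := (Sens D K → Equiv.Perm (Fin D)) × (Fin D → Sens D K → F)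
  law := stdSimplex.barycenter
  Key := Fin D × Fin K × Fin b
  QueryD := fun n => (Others D K n → F) × (Others D K n → Fin D)
  QueryC := (Fin D → Sens D K → F) × (Fin D → Sens D K → Fin D)
  AnsD := fun _ => Fin b
  AnsC := Fin D × Fin K × Fin b
  queryD := fun v u n =>
    (fun z => u.2 n (extend n (v.1 n) z) + if extend n (v.1 n) z = v.1 then 1 else 0,
     fun z => u.1 (extend n (v.1 n) z) n)
  queryC := fun _ u => (u.2, fun n x => u.1 x n)
  answerD := fun n k _ q W s t => ∑ z, q.1 z * W z (q.2 z, t) + s (n, k, t)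
  answerC := fun _ q W s r =>
    ∑ x with x r.1 = r.2.1, q.1 r.1 x * W x (q.2 r.1 x, r.2.2) + s r

/-! ### The DAPAC scheme -/

/-- The pairs `{n, m}` of dedicated servers, with `n < m`. -/
abbrev ServerPair (D : ℕ) : Type := {p : Fin D × Fin D // p.1 < p.2}

/-- The pair `{n, m}`. -/
def pairOf {D : ℕ} (n : Fin D) (m : {m : Fin D // m ≠ n}) : ServerPair D :=
  if h : n < m.1 then ⟨(n, m.1), h⟩ else ⟨(m.1, n), lt_of_le_of_ne (not_lt.mp h) m.2⟩

/-- The index of the common randomness `s_{nm}^{(k,k')} = s_{mn}^{(k',k)}`. -/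
def pairKey {D K : ℕ} (n : Fin D) (m : {m : Fin D // m ≠ n}) (k k' : Fin K) :
    ServerPair D × Fin K × Fin K :=
  (pairOf n m, if n < m.1 then (k, k') else (k', k))

/-- The `(D, K)` DAPAC scheme with `D choose 2` sub-packets of `a` symbols each, as a
HetDAPAC scheme: the central server takes no part in the retrieval phase, and nothing is
downloaded from it.

The user draws a uniform permutation `π_x` of the sub-packets for each accessible message and
uniform coefficients `g p x` for each pair `p`. From dedicated server `n` it requests, for each
other dedicated server `m` and each `k`, a linear combination of the messages `x` with
`x n = k_n`, `x m = k`, where message `x` is represented by its sub-packet `π_x({n, m})` and has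
coefficient `g {n, m} x`, except that the server of larger index in the pair is sent
`g {n, m} x + 1` if `x` is the designated message. Here the vector `Others D K n → F` for the
pair `(n, m)` consists of the `K` coefficient vectors, one for each `k`. The server adds
`s_{nm}^{(k_n, k)}`. -/
noncomputable def dapacScheme (N D K : ℕ) (F : Type) [Field F] [Fintype F] (a : ℕ) :
    Scheme N D K F (ServerPair D × Fin a) where
  Rand := (Sens D K → Equiv.Perm (ServerPair D)) × (ServerPair D → Sens D K → F)
  law := stdSimplex.barycenter
  Key := (ServerPair D × Fin K × Fin K) × Fin a
  QueryD := fun n => {m : Fin D // m ≠ n} →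
    (Others D K n → F) × (Others D K n → ServerPair D)
  QueryC := Unit
  AnsD := fun n => {m : Fin D // m ≠ n} × Fin K × Fin a
  AnsC := Empty
  queryD := fun v u n m =>
    (fun z => u.2 (pairOf n m) (extend n (v.1 n) z) +
        if m.1 < n ∧ extend n (v.1 n) z = v.1 then 1 else 0,
     fun z => u.1 (extend n (v.1 n) z) (pairOf n m))
  queryC := fun _ _ => ()
  answerD := fun n k _ q W s r =>
    ∑ z with z r.1 = r.2.1, (q r.1).1 z * W z ((q r.1).2 z, r.2.2) +
      s (pairKey n r.1 k r.2.1, r.2.2)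
  answerC := fun _ _ _ _ e => e.elim

/-! ### Rate–load-ratio pairs -/

/-- Time-sharing of the DAPAC scheme, on `(D choose 2) * a` symbols of each message, and
Scheme 1, on the other `D * b` symbols. -/
noncomputable abbrev sharedScheme (N D K : ℕ) (F : Type) [Field F] [Fintype F] (a b : ℕ) :
    Scheme N D K F (ServerPair D × Fin a ⊕ Fin D × Fin b) :=
  timeShare (dapacScheme N D K F a) (scheme1 N D K F b)

/-- `(R, ℓ)` is exactly the rate–load-ratio pair of a time-sharing scheme of positive message
length that is feasible, whatever the laws of the attributes and of the messages are. -/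
def Attained (N D K : ℕ) (F : Type) [Field F] [Fintype F] : Set (ℝ × ℝ≥0∞) :=
  {P | ∃ a b : ℕ, 0 < Fintype.card (ServerPair D × Fin a ⊕ Fin D × Fin b) ∧
    (∀ pX pY pW, (sharedScheme N D K F a b).Feasible pX pY pW) ∧
    (sharedScheme N D K F a b).Symmetric ∧
    (sharedScheme N D K F a b).rate = P.1 ∧ (sharedScheme N D K F a b).HasLoadRatio P.2}

/-- `R(lam) = 1 / (K (1 + lam) + (1 - lam))`, where `lam` is the fraction of each message that is
retrieved with the DAPAC scheme. -/
noncomputable def tsRate (K : ℕ) (lam : ℝ) : ℝ := 1 / (K * (1 + lam) + (1 - lam))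

/-- `ℓ(lam) = (2 K lam + 1 - lam) / (K D (1 - lam))`, which is `∞` for `lam = 1`. -/
noncomputable def tsLoad (D K : ℕ) (lam : ℝ) : ℝ≥0∞ :=
  ENNReal.ofReal (2 * K * lam + 1 - lam) / ENNReal.ofReal (K * D * (1 - lam))

/-- The trade-off function `ℓ ↦ 1 / (K + (ℓ K² D + K) / (ℓ K D + 2 K - 1))`. -/
noncomputable def tradeoff (D K : ℕ) (l : ℝ) : ℝ :=
  1 / (K + (l * K ^ 2 * D + K) / (l * K * D + 2 * K - 1))

end HetDAPAC

/-!
The scheme is feasible for a reason that involves no probabilities, recorded in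
`Scheme.PointwiseFeasible`.

* Correctness: the two answers that use the same common randomness (the central and a dedicated
  server in Scheme 1, the two servers of a pair in the DAPAC scheme) are the same masked linear
  combination, up to one sub-packet of the designated message (`scheme1_aD_eq`, `dapac_aD_eq`).
  Their difference is that sub-packet, and all sub-packets are reached because they are
  permuted.
* Database secrecy: every such combination carries its own block of the common randomness. The
  translation of the common randomness by the combinations preserves the mass function, and after
  it queries and answers are functions of the private randomness, the designated message and the
  translated common randomness, which are independent of the other messages.
* Attribute privacy: translating the uniform coefficients by the unit vector at the designated
  message is a law-preserving permutation of the private randomness. It turns the query to a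
  server into one that depends only on the attributes the server knows.

These properties pass to time-shared schemes (`Scheme.PointwiseFeasible.timeShare`) and imply the
entropy identities for all laws of the attributes and of the messages
(`Scheme.PointwiseFeasible.feasible`): after a change of variables the sample space is a product
on whose factors the random variables depend separately (`condMutualInfo_prod_eq_zero`).

The rate and the load ratio are found by counting. A rational fraction `p / q` is realised by
`a = 2 p` and `b = (D - 1) (q - p)`; continuity of the pair in `lam`, up to and including
`lam = 1`, gives the real fractions. The load ratio is a fractional linear function of `lam`, and
inverting it gives the trade-off curve.
-/

namespace HetDAPAC

/-! ### Entropy on finite probability spaces -/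

section Entropy

variable {Ω Ω' α β γ : Type*} [Fintype Ω] [Fintype Ω']

/-- Entropy as the expectation of `-log P(X = X(ω))`. In this form, identities between entropies
can be checked sample point by sample point. -/
theorem entropy_eq_sum (p : Ω → ℝ) (X : Ω → α) :
    entropy p X = ∑ ω, -(p ω * Real.log (prob p X (X ω))) := by
  classical
  unfold entropy
  rw [← Finset.sum_fiberwise_of_maps_to (s := Finset.univ) (t := Finset.univ.image X) (g := X)
    (fun ω _ => Finset.mem_image_of_mem X (Finset.mem_univ ω))]
  refine Finset.sum_congr rfl fun a _ => ?_
  have h : ∀ ω ∈ Finset.univ.filter (fun ω => X ω = a),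
      -(p ω * Real.log (prob p X (X ω))) = p ω * -Real.log (prob p X a) := by
    intro ω hω
    rw [(Finset.mem_filter.mp hω).2, mul_neg]
  rw [Finset.sum_congr rfl h, ← Finset.sum_mul, Real.negMulLog]
  simp only [prob, neg_mul, mul_neg]

open scoped Classical in
theorem prob_apply (p : Ω → ℝ) (X : Ω → α) (ω : Ω) :
    prob p X (X ω) = ∑ ω', if X ω' = X ω then p ω' else 0 := by
  rw [prob, Finset.sum_filter]

theorem prob_apply_pos {p : Ω → ℝ} (hp : ∀ ω, 0 ≤ p ω) (X : Ω → α) {ω : Ω} (hω : 0 < p ω) :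
    0 < prob p X (X ω) := by
  refine hω.trans_le ?_
  unfold prob
  exact Finset.single_le_sum (fun i _ => hp i) (by simp)

/-- The entropy of `X` depends only on the partition of the sample space into the fibres of `X`. -/
theorem entropy_congr (p : Ω → ℝ) {X : Ω → α} {Y : Ω → β}
    (h : ∀ ω ω', X ω = X ω' ↔ Y ω = Y ω') : entropy p X = entropy p Y := by
  classical
  simp only [entropy_eq_sum, prob_apply, h]

theorem condEntropy_eq_zero (p : Ω → ℝ) {X : Ω → α} {Y : Ω → β}
    (h : ∀ ω ω', Y ω = Y ω' → X ω = X ω') : condEntropy p X Y = 0 := by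
  rw [condEntropy, sub_eq_zero]
  refine entropy_congr p fun ω ω' => ?_
  rw [Prod.mk.injEq]
  exact ⟨fun hh => hh.2, fun hh => ⟨h ω ω' hh, hh⟩⟩

theorem entropy_comp_equiv (e : Ω' ≃ Ω) (p : Ω → ℝ) (X : Ω → α) :
    entropy (fun ω => p (e ω)) (fun ω => X (e ω)) = entropy p X := by
  classical
  simp only [entropy_eq_sum, prob_apply]
  rw [← Equiv.sum_comp e]
  refine Finset.sum_congr rfl fun ω _ => ?_
  rw [← Equiv.sum_comp e (fun ω' => if X ω' = X (e ω) then p ω' else 0)]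

theorem mutualInfo_comp_equiv (e : Ω' ≃ Ω) (p : Ω → ℝ) (X : Ω → α) (Y : Ω → β) :
    mutualInfo (fun ω => p (e ω)) (fun ω => X (e ω)) (fun ω => Y (e ω)) = mutualInfo p X Y := by
  simp only [mutualInfo, condEntropy, entropy_comp_equiv e p X, entropy_comp_equiv e p Y,
    entropy_comp_equiv e p (fun ω => (X ω, Y ω))]

theorem condMutualInfo_comp_equiv (e : Ω' ≃ Ω) (p : Ω → ℝ) (X : Ω → α) (Y : Ω → β) (Z : Ω → γ) :
    condMutualInfo (fun ω => p (e ω)) (fun ω => X (e ω)) (fun ω => Y (e ω)) (fun ω => Z (e ω)) =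
      condMutualInfo p X Y Z := by
  simp only [condMutualInfo, condEntropy, entropy_comp_equiv e p Z,
    entropy_comp_equiv e p (fun ω => (X ω, Z ω)), entropy_comp_equiv e p (fun ω => (Y ω, Z ω)),
    entropy_comp_equiv e p (fun ω => (X ω, Y ω, Z ω))]

/-- Conditional independence `P(x, y, z) P(z) = P(x, z) P(y, z)` gives `I(X; Y | Z) = 0`. -/
theorem condMutualInfo_eq_zero_of_prob {p : Ω → ℝ} (hp : ∀ ω, 0 ≤ p ω) {X : Ω → α} {Y : Ω → β}
    {Z : Ω → γ}
    (h : ∀ ω, prob p (fun ω => (X ω, Y ω, Z ω)) (X ω, Y ω, Z ω) * prob p Z (Z ω) =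
      prob p (fun ω => (X ω, Z ω)) (X ω, Z ω) * prob p (fun ω => (Y ω, Z ω)) (Y ω, Z ω)) :
    condMutualInfo p X Y Z = 0 := by
  classical
  simp only [condMutualInfo, condEntropy, entropy_eq_sum, ← Finset.sum_sub_distrib]
  refine Finset.sum_eq_zero fun ω _ => ?_
  rcases (hp ω).eq_or_lt with h0 | h0
  · simp [← h0]
  have hl := congrArg Real.log (h ω)
  rw [Real.log_mul (prob_apply_pos hp (fun ω => (X ω, Y ω, Z ω)) h0).ne'
      (prob_apply_pos hp Z h0).ne',
    Real.log_mul (prob_apply_pos hp (fun ω => (X ω, Z ω)) h0).ne'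
      (prob_apply_pos hp (fun ω => (Y ω, Z ω)) h0).ne'] at hl
  linear_combination p ω * hl

/-- On a product space `A × B × C` with a product mass function, `X` and `Y` are conditionally
independent given the coordinate in `C`, if `X` does not depend on the coordinate in `B` and `Y`
does not depend on the one in `A`. -/
theorem condMutualInfo_prod_eq_zero {A B C : Type*} [Fintype A] [Fintype B] [Fintype C]
    {f : A → ℝ} {g : B → ℝ} {h : C → ℝ} (hf : ∀ a, 0 ≤ f a) (hg : ∀ b, 0 ≤ g b)
    (hh : ∀ c, 0 ≤ h c) (X : A → C → α) (Y : B → C → β) {Z : C → γ}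
    (hZ : Function.Injective Z) :
    condMutualInfo (fun ω : A × B × C => f ω.1 * g ω.2.1 * h ω.2.2)
      (fun ω => X ω.1 ω.2.2) (fun ω => Y ω.2.1 ω.2.2) (fun ω => Z ω.2.2) = 0 := by
  classical
  refine condMutualInfo_eq_zero_of_prob
    (fun ω => mul_nonneg (mul_nonneg (hf _) (hg _)) (hh _)) fun ω => ?_
  obtain ⟨a, b, c⟩ := ω
  -- Each of the four probabilities factors along the three coordinates.
  have key : ∀ (P : A → C → Prop) (Q : B → C → Prop),
      ∑ ω : A × B × C, (if (P ω.1 ω.2.2 ∧ Q ω.2.1 ω.2.2) ∧ ω.2.2 = c then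
        f ω.1 * g ω.2.1 * h ω.2.2 else 0) =
      (∑ a', if P a' c then f a' else 0) * (∑ b', if Q b' c then g b' else 0) * h c := by
    intro P Q
    simp only [Fintype.sum_prod_type, Finset.sum_mul_sum]
    simp only [Finset.sum_mul]
    refine Finset.sum_congr rfl fun a' _ => Finset.sum_congr rfl fun b' _ => ?_
    rw [Finset.sum_eq_single c (fun c' _ hc => by simp [hc]) (by simp)]
    by_cases h1 : P a' c <;> by_cases h2 : Q b' c <;> simp [h1, h2]
  have k1 := key (fun a' c' => X a' c' = X a c) (fun b' c' => Y b' c' = Y b c)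
  have k2 := key (fun _ _ => True) (fun _ _ => True)
  have k3 := key (fun a' c' => X a' c' = X a c) (fun _ _ => True)
  have k4 := key (fun _ _ => True) (fun b' c' => Y b' c' = Y b c)
  simp only [true_and, and_true] at k2 k3 k4
  simp only [prob, Finset.sum_filter, Prod.mk.injEq, hZ.eq_iff, ← and_assoc]
  refine (congrArg₂ (· * ·) ((Finset.sum_congr rfl ?_).trans k1)
    ((Finset.sum_congr rfl ?_).trans k2)).trans (Eq.trans ?_ (congrArg₂ (· * ·)
    ((Finset.sum_congr rfl ?_).trans k3) ((Finset.sum_congr rfl ?_).trans k4)).symm)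
  · intros; congr!
  · intros; congr!
  · simp only [if_true]; ring
  · intros; congr!
  · intros; congr!

theorem mutualInfo_prod_eq_zero {A B : Type*} [Fintype A] [Fintype B] {f : A → ℝ} {g : B → ℝ}
    (hf : ∀ a, 0 ≤ f a) (hg : ∀ b, 0 ≤ g b) (hf1 : ∑ a, f a = 1) (hg1 : ∑ b, g b = 1)
    (X : A → α) (Y : B → β) :
    mutualInfo (fun ω : A × B => f ω.1 * g ω.2) (fun ω => X ω.1) (fun ω => Y ω.2) = 0 := by
  have h := condMutualInfo_prod_eq_zero (C := Unit) (h := fun _ => 1) hf hg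
    (fun _ => zero_le_one) (fun a _ => X a) (fun b _ => Y b) (Z := id) Function.injective_id
  rw [← condMutualInfo_comp_equiv
    ((Equiv.prodPUnit (A × B)).symm.trans (Equiv.prodAssoc A B Unit))] at h
  rw [← h]
  -- Conditioning on a constant changes nothing, because the total mass is one.
  have h0 : entropy (fun ω : A × B => f ω.1 * g ω.2 * 1) (fun _ => ()) = 0 := by
    have h1 : ∑ ω : A × B, f ω.1 * g ω.2 = 1 := by
      rw [Fintype.sum_prod_type]
      simp only [← Finset.mul_sum, hg1, mul_one, hf1]
    simp [entropy_eq_sum, prob, h1]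
  have hX : entropy (fun ω : A × B => f ω.1 * g ω.2 * 1) (fun ω => (X ω.1, ())) =
      entropy (fun ω : A × B => f ω.1 * g ω.2) (fun ω => X ω.1) := by
    simp only [mul_one]
    exact entropy_congr _ (by simp)
  have hY : entropy (fun ω : A × B => f ω.1 * g ω.2 * 1) (fun ω => (Y ω.2, ())) =
      entropy (fun ω : A × B => f ω.1 * g ω.2) (fun ω => Y ω.2) := by
    simp only [mul_one]
    exact entropy_congr _ (by simp)
  have hXY : entropy (fun ω : A × B => f ω.1 * g ω.2 * 1) (fun ω => (X ω.1, Y ω.2, ())) =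
      entropy (fun ω : A × B => f ω.1 * g ω.2) (fun ω => (X ω.1, Y ω.2)) := by
    simp only [mul_one]
    exact entropy_congr _ (by simp)
  simp only [mutualInfo, condMutualInfo, condEntropy]
  change _ = entropy (fun ω : A × B => f ω.1 * g ω.2 * 1) (fun ω => (X ω.1, ())) -
    entropy (fun ω : A × B => f ω.1 * g ω.2 * 1) (fun _ => ()) -
    (entropy (fun ω : A × B => f ω.1 * g ω.2 * 1) (fun ω => (X ω.1, Y ω.2, ())) -
      entropy (fun ω : A × B => f ω.1 * g ω.2 * 1) (fun ω => (Y ω.2, ())))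
  rw [h0, hX, hY, hXY, sub_zero]

end Entropy

/-! ### Splitting off one sensitive attribute -/

section Extend

variable {D K : ℕ}

@[simp] theorem extend_self (n : Fin D) (k : Fin K) (z : Others D K n) : extend n k z n = k := by
  simp [extend]

@[simp] theorem others_extend (n : Fin D) (k : Fin K) (z : Others D K n) :
    others n (extend n k z) = z := by
  funext i
  simp [others, extend, i.2]

@[simp] theorem extend_others (n : Fin D) (x : Sens D K) : extend n (x n) (others n x) = x := by
  funext i
  by_cases h : i = n
  · subst h; simp
  · simp [others, extend, h]

theorem extend_apply_of_ne {n : Fin D} (m : {m : Fin D // m ≠ n}) (k : Fin K)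
    (z : Others D K n) : extend n k z m.1 = z m := by
  simp [extend, m.2]

/-- The values `z` of the other attributes run over the sensitive vectors with `n`-th entry `k`. -/
theorem sum_extend {M : Type*} [AddCommMonoid M] (n : Fin D) (k : Fin K)
    (P : Others D K n → Prop) (Q : Sens D K → Prop) [DecidablePred P] [DecidablePred Q]
    (hPQ : ∀ z, Q (extend n k z) ↔ P z) (hQ : ∀ x, Q x → x n = k) (f : Sens D K → M) :
    ∑ z with P z, f (extend n k z) = ∑ x with Q x, f x := by
  refine Finset.sum_bij' (fun z _ => extend n k z) (fun x _ => others n x) ?_ ?_ ?_ ?_ ?_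
  · intro z hz
    simpa [hPQ] using hz
  · intro x hx
    have hx' := (Finset.mem_filter.mp hx).2
    have := hQ x hx'
    subst this
    simpa [← hPQ] using hx'
  · simp
  · intro x hx
    have := hQ x (Finset.mem_filter.mp hx).2
    subst this
    simp
  · simp

end Extend

namespace Scheme

/-! ### A criterion for feasibility without probabilities -/

section PointwiseFeasible

variable {N D K : ℕ} {F ι : Type}

theorem sum_law (Sc : Scheme N D K F ι) : ∑ u, Sc.law u = 1 := Sc.law.2.2

theorem law_nonneg (Sc : Scheme N D K F ι) (u : Sc.Rand) : 0 ≤ Sc.law u := Sc.law.2.1 u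

theorem prod_law_nonneg {I X : Type*} [Fintype X] (s : Finset I) (p : I → stdSimplex ℝ X)
    (x : I → X) : 0 ≤ ∏ i ∈ s, p i (x i) :=
  Finset.prod_nonneg fun i _ => (p i).2.1 (x i)

theorem sum_prod_law {I X : Type*} [Fintype I] [DecidableEq I] [Fintype X]
    (p : I → stdSimplex ℝ X) : ∑ x : I → X, ∏ i, p i (x i) = 1 := by
  have h : ∀ i, ∑ x, p i x = 1 := fun i => (p i).2.2
  rw [← Fintype.prod_sum]
  simp [h]

variable [Field F]

/-- Properties of a scheme that involve no laws of the attributes and the messages, and that make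
it feasible for all of them. In `masked`, the vector `s + φ u W` is uniform on `Key → F` given
the private randomness `u` and the messages `W`, so that queries and answers are functions of
`u`, the designated message and symbols that are independent of all the messages. In `privateD`,
the permutation `σ v` preserves the law of the private randomness, so that the law of the query
to server `n` depends only on the attributes known to that server. -/
structure PointwiseFeasible (Sc : Scheme N D K F ι) : Prop where
  decodable : ∀ v ω ω', Sc.queries v ω = Sc.queries v ω' → Sc.answers v ω = Sc.answers v ω' →
    Sc.msgs ω v = Sc.msgs ω' v
  masked : ∀ v, ∃ (φ : Sc.Rand → (Attr N D K → ι → F) → Sc.Key → F)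
    (G : Sc.Rand → (ι → F) → (Sc.Key → F) → (∀ n, Sc.AnsD n → F) × (Sc.AnsC → F)),
    ∀ u W s, Sc.answers v (u, W, s) = G u (W v) (s + φ u W)
  privateD : ∀ n, ∃ (σ : Attr N D K → Equiv.Perm Sc.Rand)
    (Q : Fin K → Pub N D K → Sc.Rand → Sc.QueryD n),
    ∀ v u, Sc.law (σ v u) = Sc.law u ∧ Sc.queryD v u n = Q (v.1 n) v.2 (σ v u)
  privateC : ∃ Q : Pub N D K → Sc.Rand → Sc.QueryC, ∀ v u, Sc.queryC v u = Q v.2 u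

theorem sum_key_eq_one [Fintype F] (Sc : Scheme N D K F ι) :
    ∑ _s : Sc.Key → F, ((Fintype.card F : ℝ) ^ Fintype.card Sc.Key)⁻¹ = 1 := by
  have : (Fintype.card F : ℝ) ≠ 0 := Nat.cast_ne_zero.mpr Fintype.card_ne_zero
  simp [this]

theorem key_nonneg [Fintype F] (Sc : Scheme N D K F ι) :
    0 ≤ ((Fintype.card F : ℝ) ^ Fintype.card Sc.Key)⁻¹ := by positivity

variable {Sc : Scheme N D K F ι} [Fintype F] [DecidableEq ι] [Fintype ι]

theorem mutualInfo_queries_msgs (pW : Attr N D K → stdSimplex ℝ (ι → F)) (v : Attr N D K) :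
    mutualInfo (Sc.mass pW) (Sc.queries v) Sc.msgs = 0 := by
  have h := mutualInfo_prod_eq_zero
    (f := fun u => Sc.law u)
    (g := fun b : (Attr N D K → ι → F) × (Sc.Key → F) =>
      (∏ v, pW v (b.1 v)) * ((Fintype.card F : ℝ) ^ Fintype.card Sc.Key)⁻¹)
    Sc.law_nonneg
    (fun b => mul_nonneg (prod_law_nonneg _ _ _) Sc.key_nonneg) Sc.sum_law
    (by
      rw [Fintype.sum_prod_type]
      simp only [← Finset.mul_sum, sum_key_eq_one, mul_one, sum_prod_law])
    (fun u => ((fun n => Sc.queryD v u n, Sc.queryC v u) : (∀ n, Sc.QueryD n) × Sc.QueryC))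
    (fun b => b.1)
  simp only [← mul_assoc] at h
  exact h

theorem PointwiseFeasible.secrecy (hS : Sc.PointwiseFeasible)
    (pW : Attr N D K → stdSimplex ℝ (ι → F)) (v : Attr N D K) :
    mutualInfo (Sc.mass pW) (fun ω => fun w : {w : Attr N D K // w ≠ v} => Sc.msgs ω w.1)
      (fun ω => (Sc.queries v ω, Sc.answers v ω)) = 0 := by
  obtain ⟨φ, G, hG⟩ := hS.masked v
  -- Coordinates on the sample space: the other messages, the designated message, the private
  -- randomness, and the masking symbols `s + φ u W`.
  let e : ({w : Attr N D K // w ≠ v} → ι → F) × ((ι → F) × Sc.Rand × (Sc.Key → F)) ≃ Sc.Omega :=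
    { toFun := fun x => (x.2.2.1, (Equiv.funSplitAt v (ι → F)).symm (x.2.1, x.1),
        x.2.2.2 - φ x.2.2.1 ((Equiv.funSplitAt v (ι → F)).symm (x.2.1, x.1)))
      invFun := fun ω => (fun w => ω.2.1 w.1, ω.2.1 v, ω.1, ω.2.2 + φ ω.1 ω.2.1)
      left_inv := by
        rintro ⟨Wo, w, u, r⟩
        simp only [sub_add_cancel, Prod.mk.injEq, and_true]
        have h := (Equiv.funSplitAt v (ι → F)).apply_symm_apply (w, Wo)
        exact ⟨congrArg Prod.snd h, congrArg Prod.fst h⟩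
      right_inv := by
        rintro ⟨u, W, s⟩
        have h : (Equiv.funSplitAt v (ι → F)).symm (W v, fun w => W w.1) = W :=
          (Equiv.funSplitAt v (ι → F)).symm_apply_apply W
        simp only [h, add_sub_cancel_right] }
  have hv : ∀ x, (e x).2.1 v = x.2.1 := fun x =>
    congrArg (fun y => y.2.1) (e.symm_apply_apply x)
  have ho : ∀ x, (fun w : {w : Attr N D K // w ≠ v} => (e x).2.1 w.1) = x.1 := fun x =>
    congrArg (fun y => y.1) (e.symm_apply_apply x)
  rw [← mutualInfo_comp_equiv e]
  have h := mutualInfo_prod_eq_zero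
    (f := fun Wo : {w : Attr N D K // w ≠ v} → ι → F => ∏ w, pW w.1 (Wo w))
    (g := fun b : (ι → F) × Sc.Rand × (Sc.Key → F) =>
      pW v b.1 * (Sc.law b.2.1 * ((Fintype.card F : ℝ) ^ Fintype.card Sc.Key)⁻¹))
    (fun Wo => prod_law_nonneg _ (fun w : {w : Attr N D K // w ≠ v} => pW w.1) Wo)
    (fun b => mul_nonneg ((pW v).2.1 _) (mul_nonneg (Sc.law_nonneg _) Sc.key_nonneg))
    (sum_prod_law fun w : {w : Attr N D K // w ≠ v} => pW w.1)
    (by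
      have h1 : ∑ w, pW v w = 1 := (pW v).2.2
      simp only [Fintype.sum_prod_type, ← Finset.mul_sum, sum_key_eq_one, mul_one, sum_law, h1])
    (fun Wo => Wo)
    (fun b => (((fun n => Sc.queryD v b.2.1 n, Sc.queryC v b.2.1) :
      (∀ n, Sc.QueryD n) × Sc.QueryC), G b.2.1 b.1 b.2.2))
  convert h using 2
  · funext x
    have hW : ∏ w, pW w ((e x).2.1 w) = pW v x.2.1 * ∏ w : {w // w ≠ v}, pW w.1 (x.1 w) := by
      rw [Fintype.prod_eq_mul_prod_subtype_ne _ v, hv x, ← ho x]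
    have : Sc.mass pW (e x) = Sc.law x.2.2.1 * (∏ w, pW w ((e x).2.1 w)) *
        ((Fintype.card F : ℝ) ^ Fintype.card Sc.Key)⁻¹ := rfl
    rw [this, hW]
    ring
  · exact funext ho
  · funext x
    refine Prod.ext rfl ?_
    change Sc.answers v ((e x).1, (e x).2.1, (e x).2.2) = _
    rw [hG, hv]
    congr 1
    exact sub_add_cancel _ _

theorem PointwiseFeasible.privacyD (hS : Sc.PointwiseFeasible)
    (pX : Fin D → stdSimplex ℝ (Fin K)) (pY : Fin (N - D) → stdSimplex ℝ (Fin K))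
    (pW : Attr N D K → stdSimplex ℝ (ι → F)) (n : Fin D) :
    condMutualInfo (Sc.jointMass pX pY pW)
      (fun τ => Sc.qD τ.1 n τ.2) (fun τ => others n τ.1.1)
      (fun τ => (Sc.common τ.2, τ.1.2, τ.1.1 n, Sc.msgs τ.2)) = 0 := by
  obtain ⟨σ, Q, hQ⟩ := hS.privateD n
  -- Coordinates on the sample space: the transformed private randomness, on which the query
  -- depends, the attributes unknown to the server, and everything else.
  let e : Sc.Rand × Others D K n ×
      (Fin K × Pub N D K × (Attr N D K → ι → F) × (Sc.Key → F)) ≃ Attr N D K × Sc.Omega :=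
    { toFun := fun x => ((extend n x.2.2.1 x.2.1, x.2.2.2.1),
        ((σ (extend n x.2.2.1 x.2.1, x.2.2.2.1)).symm x.1, x.2.2.2.2))
      invFun := fun τ => (σ τ.1 τ.2.1, others n τ.1.1, τ.1.1 n, τ.1.2, τ.2.2)
      left_inv := by
        rintro ⟨u, z, k, y, W, s⟩
        simp
      right_inv := by
        rintro ⟨⟨x, y⟩, u, W, s⟩
        simp }
  rw [← condMutualInfo_comp_equiv e]
  have h := condMutualInfo_prod_eq_zero
    (f := fun u => Sc.law u)
    (g := fun z : Others D K n => ∏ i, pX i.1 (z i))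
    (h := fun c : Fin K × Pub N D K × (Attr N D K → ι → F) × (Sc.Key → F) =>
      pX n c.1 * ((∏ j, pY j (c.2.1 j)) * ((∏ v, pW v (c.2.2.1 v)) *
        ((Fintype.card F : ℝ) ^ Fintype.card Sc.Key)⁻¹)))
    Sc.law_nonneg
    (fun z => prod_law_nonneg _ (fun i : {i : Fin D // i ≠ n} => pX i.1) z)
    (fun c => mul_nonneg ((pX n).2.1 _) (mul_nonneg (prod_law_nonneg _ _ _)
      (mul_nonneg (prod_law_nonneg _ _ _) Sc.key_nonneg)))
    (fun u c => Q c.1 c.2.1 u) (fun z _ => z)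
    (Z := fun c => (c.2.2.2, c.2.1, c.1, c.2.2.1))
    (by
      rintro ⟨k, y, W, s⟩ ⟨k', y', W', s'⟩ h
      simp only [Prod.mk.injEq] at h ⊢
      tauto)
  convert h using 2
  · funext x
    obtain ⟨u, z, k, y, W, s⟩ := x
    have hX : ∏ i, pX i (extend n k z i) = pX n k * ∏ i : {i // i ≠ n}, pX i.1 (z i) := by
      rw [Fintype.prod_eq_mul_prod_subtype_ne _ n, extend_self]
      simp only [extend_apply_of_ne]
    have hl : Sc.law ((σ (extend n k z, y)).symm u) = Sc.law u := by
      rw [← (hQ (extend n k z, y) _).1, Equiv.apply_symm_apply]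
    have : Sc.jointMass pX pY pW (e (u, z, k, y, W, s)) =
        (∏ i, pX i (extend n k z i)) * (∏ j, pY j (y j)) *
          (Sc.law ((σ (extend n k z, y)).symm u) * (∏ v, pW v (W v)) *
            ((Fintype.card F : ℝ) ^ Fintype.card Sc.Key)⁻¹) := rfl
    rw [this, hX, hl]
    ring
  · funext x
    obtain ⟨u, z, k, y, W, s⟩ := x
    change Sc.queryD (extend n k z, y) ((σ (extend n k z, y)).symm u) n = Q k y u
    rw [(hQ _ _).2, Equiv.apply_symm_apply]
    simp
  · exact funext fun _ => others_extend _ _ _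
  · funext x
    exact Prod.ext rfl (Prod.ext rfl (Prod.ext (extend_self _ _ _) rfl))

theorem PointwiseFeasible.privacyC (hS : Sc.PointwiseFeasible)
    (pX : Fin D → stdSimplex ℝ (Fin K)) (pY : Fin (N - D) → stdSimplex ℝ (Fin K))
    (pW : Attr N D K → stdSimplex ℝ (ι → F)) :
    condMutualInfo (Sc.jointMass pX pY pW)
      (fun τ => Sc.qC τ.1 τ.2) (fun τ => τ.1.1)
      (fun τ => (Sc.common τ.2, τ.1.2, Sc.msgs τ.2)) = 0 := by
  obtain ⟨Q, hQ⟩ := hS.privateC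
  let e : Sc.Rand × Sens D K × (Pub N D K × (Attr N D K → ι → F) × (Sc.Key → F)) ≃
      Attr N D K × Sc.Omega :=
    { toFun := fun x => ((x.2.1, x.2.2.1), (x.1, x.2.2.2))
      invFun := fun τ => (τ.2.1, τ.1.1, τ.1.2, τ.2.2)
      left_inv := fun _ => rfl
      right_inv := fun _ => rfl }
  rw [← condMutualInfo_comp_equiv e]
  have h := condMutualInfo_prod_eq_zero
    (f := fun u => Sc.law u)
    (g := fun z : Sens D K => ∏ i, pX i (z i))
    (h := fun c : Pub N D K × (Attr N D K → ι → F) × (Sc.Key → F) =>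
      (∏ j, pY j (c.1 j)) * ((∏ v, pW v (c.2.1 v)) *
        ((Fintype.card F : ℝ) ^ Fintype.card Sc.Key)⁻¹))
    Sc.law_nonneg (fun z => prod_law_nonneg _ _ _)
    (fun c => mul_nonneg (prod_law_nonneg _ _ _)
      (mul_nonneg (prod_law_nonneg _ _ _) Sc.key_nonneg))
    (fun u c => Q c.1 u) (fun z _ => z)
    (Z := fun c => (c.2.2, c.1, c.2.1))
    (by
      rintro ⟨y, W, s⟩ ⟨y', W', s'⟩ h
      simp only [Prod.mk.injEq] at h ⊢
      tauto)
  convert h using 2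
  · funext x
    obtain ⟨u, z, y, W, s⟩ := x
    have : Sc.jointMass pX pY pW (e (u, z, y, W, s)) =
        (∏ i, pX i (z i)) * (∏ j, pY j (y j)) *
          (Sc.law u * (∏ v, pW v (W v)) *
            ((Fintype.card F : ℝ) ^ Fintype.card Sc.Key)⁻¹) := rfl
    rw [this]
    ring
  · exact funext fun _ => hQ _ _
  · rfl
  · rfl

theorem PointwiseFeasible.feasible (hS : Sc.PointwiseFeasible)
    (pX : Fin D → stdSimplex ℝ (Fin K)) (pY : Fin (N - D) → stdSimplex ℝ (Fin K))
    (pW : Attr N D K → stdSimplex ℝ (ι → F)) : Sc.Feasible pX pY pW where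
  queries_indep := mutualInfo_queries_msgs pW
  answerD_determined v n := condEntropy_eq_zero _ fun ω ω' h => by
    simp only [Prod.mk.injEq] at h
    simp only [aD, h.1, h.2.1, h.2.2]
  answerC_determined v := condEntropy_eq_zero _ fun ω ω' h => by
    simp only [Prod.mk.injEq] at h
    simp only [aC, h.1, h.2.1, h.2.2]
  correctness v := condEntropy_eq_zero _ fun ω ω' h =>
    hS.decodable v ω ω' (congrArg Prod.fst h) (congrArg Prod.snd h)
  privacyD := hS.privacyD pX pY pW
  privacyC := hS.privacyC pX pY pW
  secrecy := hS.secrecy pW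

end PointwiseFeasible

end Scheme

/-! ### Feasibility of the time-sharing scheme -/

section TimeShare

variable {N D K : ℕ} {F : Type} [Field F]

theorem Scheme.PointwiseFeasible.timeShare {ι₁ ι₂ : Type} {A : Scheme N D K F ι₁}
    {B : Scheme N D K F ι₂} (hA : A.PointwiseFeasible) (hB : B.PointwiseFeasible) :
    (timeShare A B).PointwiseFeasible where
  decodable := by
    intro v ω ω' hq ha
    have h1 : (fun i => ω.2.1 v (Sum.inl i)) = fun i => ω'.2.1 v (Sum.inl i) :=
      hA.decodable v
        (ω.1.1, (fun v i => ω.2.1 v (Sum.inl i)), fun j => ω.2.2 (Sum.inl j))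
        (ω'.1.1, (fun v i => ω'.2.1 v (Sum.inl i)), fun j => ω'.2.2 (Sum.inl j))
        (Prod.ext (funext fun n => congrArg (fun q => (q.1 n).1) hq)
          (congrArg (fun q => q.2.1) hq))
        (Prod.ext (funext fun n => funext fun i => congrArg (fun a => a.1 n (Sum.inl i)) ha)
          (funext fun i => congrArg (fun a => a.2 (Sum.inl i)) ha))
    have h2 : (fun i => ω.2.1 v (Sum.inr i)) = fun i => ω'.2.1 v (Sum.inr i) :=
      hB.decodable v
        (ω.1.2, (fun v i => ω.2.1 v (Sum.inr i)), fun j => ω.2.2 (Sum.inr j))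
        (ω'.1.2, (fun v i => ω'.2.1 v (Sum.inr i)), fun j => ω'.2.2 (Sum.inr j))
        (Prod.ext (funext fun n => congrArg (fun q => (q.1 n).2) hq)
          (congrArg (fun q => q.2.2) hq))
        (Prod.ext (funext fun n => funext fun i => congrArg (fun a => a.1 n (Sum.inr i)) ha)
          (funext fun i => congrArg (fun a => a.2 (Sum.inr i)) ha))
    funext i
    rcases i with i | i
    · exact congrFun h1 i
    · exact congrFun h2 i
  masked := by
    intro v
    obtain ⟨φ, G, hG⟩ := hA.masked v
    obtain ⟨φ', G', hG'⟩ := hB.masked v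
    refine ⟨fun u W => Sum.elim (φ u.1 fun v i => W v (Sum.inl i))
        (φ' u.2 fun v i => W v (Sum.inr i)),
      fun u w r =>
        (fun n => Sum.elim ((G u.1 (fun i => w (Sum.inl i)) fun j => r (Sum.inl j)).1 n)
          ((G' u.2 (fun i => w (Sum.inr i)) fun j => r (Sum.inr j)).1 n),
        Sum.elim (G u.1 (fun i => w (Sum.inl i)) fun j => r (Sum.inl j)).2
          (G' u.2 (fun i => w (Sum.inr i)) fun j => r (Sum.inr j)).2), ?_⟩
    intro u W s
    have h := hG u.1 (fun v i => W v (Sum.inl i)) (fun j => s (Sum.inl j))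
    have h' := hG' u.2 (fun v i => W v (Sum.inr i)) (fun j => s (Sum.inr j))
    exact Prod.ext
      (funext fun n => congrArg₂ Sum.elim (congrArg (fun a => a.1 n) h)
        (congrArg (fun a => a.1 n) h'))
      (congrArg₂ Sum.elim (congrArg (fun a => a.2) h) (congrArg (fun a => a.2) h'))
  privateD := by
    intro n
    obtain ⟨σ, Q, hQ⟩ := hA.privateD n
    obtain ⟨σ', Q', hQ'⟩ := hB.privateD n
    refine ⟨fun v => (σ v).prodCongr (σ' v), fun k y u => (Q k y u.1, Q' k y u.2), ?_⟩
    intro v u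
    exact ⟨congrArg₂ (· * ·) (hQ v u.1).1 (hQ' v u.2).1, Prod.ext (hQ v u.1).2 (hQ' v u.2).2⟩
  privateC := by
    obtain ⟨Q, hQ⟩ := hA.privateC
    obtain ⟨Q', hQ'⟩ := hB.privateC
    exact ⟨fun y u => (Q y u.1, Q' y u.2), fun v u => Prod.ext (hQ v u.1) (hQ' v u.2)⟩

end TimeShare

/-! ### Feasibility of Scheme 1 -/

section Scheme1

variable {N D K : ℕ} {F : Type} [Field F] [Fintype F]

/-- In Scheme 1, the answer of a dedicated server is the answer of the central server for the
same message group plus a sub-packet of the designated message. -/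
theorem scheme1_aD_eq {b : ℕ} (v : Attr N D K) (ω : (scheme1 N D K F b).Omega) (n : Fin D)
    (t : Fin b) :
    (scheme1 N D K F b).aD v n ω t =
      (scheme1 N D K F b).aC v ω (n, v.1 n, t) + ω.2.1 v (ω.1.1 v.1 n, t) := by
  obtain ⟨⟨π, h⟩, W, s⟩ := ω
  change ∑ z, (h n (extend n (v.1 n) z) + if extend n (v.1 n) z = v.1 then 1 else 0) *
      W (extend n (v.1 n) z, v.2) (π (extend n (v.1 n) z) n, t) + s (n, v.1 n, t) =
    (∑ x with x n = v.1 n, h n x * W (x, v.2) (π x n, t) + s (n, v.1 n, t)) + W v (π v.1 n, t)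
  have h1 := sum_extend n (v.1 n) (fun _ => True) (fun x => x n = v.1 n) (by simp)
    (fun _ hx => hx)
    (fun x => (h n x + if x = v.1 then 1 else 0) * W (x, v.2) (π x n, t))
  simp only [Finset.filter_true] at h1
  rw [h1]
  simp only [add_mul, ite_mul, one_mul, zero_mul, Finset.sum_add_distrib]
  rw [Finset.sum_ite_eq' _ v.1 (fun x => W (x, v.2) (π x n, t)), if_pos (by simp)]
  ring

theorem scheme1_pointwiseFeasible (b : ℕ) : (scheme1 N D K F b).PointwiseFeasible where
  decodable := by
    intro v ω ω' hq ha
    funext ⟨i, t⟩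
    have hπ : ω.1.1 v.1 = ω'.1.1 v.1 :=
      Equiv.ext fun n => congrArg (fun q => q.2.2 n v.1) hq
    have h1 := scheme1_aD_eq v ω ((ω.1.1 v.1).symm i) t
    have h2 := scheme1_aD_eq v ω' ((ω.1.1 v.1).symm i) t
    rw [Equiv.apply_symm_apply] at h1
    rw [← hπ, Equiv.apply_symm_apply] at h2
    have h3 : (scheme1 N D K F b).aD v ((ω.1.1 v.1).symm i) ω t =
        (scheme1 N D K F b).aD v ((ω.1.1 v.1).symm i) ω' t :=
      congrFun (congrFun (congrArg Prod.fst ha) _) t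
    have h4 : (scheme1 N D K F b).aC v ω = (scheme1 N D K F b).aC v ω' := congrArg Prod.snd ha
    rw [h1, h2, h4] at h3
    exact add_left_cancel h3
  masked := by
    intro v
    refine ⟨fun u W r => ∑ x with x r.1 = r.2.1, u.2 r.1 x * W (x, v.2) (u.1 x r.1, r.2.2),
      fun u w r => (fun n t => r (n, v.1 n, t) + w (u.1 v.1 n, t), r), ?_⟩
    intro u W s
    have hC : (scheme1 N D K F b).aC v (u, W, s) = s + fun r =>
        ∑ x with x r.1 = r.2.1, u.2 r.1 x * W (x, v.2) (u.1 x r.1, r.2.2) :=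
      funext fun r => add_comm _ _
    refine Prod.ext (funext fun n => funext fun t => ?_) hC
    exact (scheme1_aD_eq v (u, W, s) n t).trans
      (congrArg (· + W v (u.1 v.1 n, t)) (congrFun hC (n, v.1 n, t)))
  privateD := by
    intro n
    refine ⟨fun v => (Equiv.refl _).prodCongr
        (Equiv.addRight fun _ x => if x = v.1 then 1 else 0),
      fun k _ u => (fun z => u.2 n (extend n k z), fun z => u.1 (extend n k z) n), ?_⟩
    -- The law of the private randomness is uniform, hence invariant under every permutation.
    exact fun v u => ⟨rfl, rfl⟩
  privateC := ⟨fun _ u => (u.2, fun n x => u.1 x n), fun _ _ => rfl⟩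

end Scheme1

/-! ### Feasibility of the DAPAC scheme -/

section Dapac

variable {N D K : ℕ} {F : Type} [Field F] [Fintype F]

theorem pairOf_snd_eq_iff (n : Fin D) (m : {m : Fin D // m ≠ n}) :
    (pairOf n m).1.2 = n ↔ m.1 < n := by
  unfold pairOf
  split_ifs with h
  · exact ⟨fun h' => absurd h' m.2, fun h' => absurd h h'.asymm⟩
  · exact ⟨fun _ => lt_of_le_of_ne (not_lt.mp h) m.2, fun _ => rfl⟩

theorem pairKey_spec (n : Fin D) (m : {m : Fin D // m ≠ n}) (k k' : Fin K) (x : Sens D K) :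
    (x (pairKey n m k k').1.1.1 = (pairKey n m k k').2.1 ∧
      x (pairKey n m k k').1.1.2 = (pairKey n m k k').2.2) ↔ x n = k ∧ x m.1 = k' := by
  unfold pairKey pairOf
  split_ifs with h
  · exact Iff.rfl
  · exact and_comm

/-- The common part of the two answers of the DAPAC scheme that use the common randomness
`s_{nm}^{(k,k')}`: the linear combination of the messages `x` with `x n = k` and `x m = k'`, with
the coefficients `g {n, m} x`, plus this common randomness. -/
noncomputable def dapacMask {a : ℕ} (y : Pub N D K) (ω : (dapacScheme N D K F a).Omega)
    (r : (ServerPair D × Fin K × Fin K) × Fin a) : F :=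
  ω.2.2 r + ∑ x with x r.1.1.1.1 = r.1.2.1 ∧ x r.1.1.1.2 = r.1.2.2,
    ω.1.2 r.1.1 x * ω.2.1 (x, y) (ω.1.1 x r.1.1, r.2)

theorem dapac_aD_eq {a : ℕ} (v : Attr N D K) (ω : (dapacScheme N D K F a).Omega) (n : Fin D)
    (m : {m : Fin D // m ≠ n}) (k : Fin K) (t : Fin a) :
    (dapacScheme N D K F a).aD v n ω (m, k, t) =
      dapacMask v.2 ω (pairKey n m (v.1 n) k, t) +
        if m.1 < n ∧ v.1 m.1 = k then ω.2.1 v (ω.1.1 v.1 (pairOf n m), t) else 0 := by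
  obtain ⟨⟨π, g⟩, W, s⟩ := ω
  change ∑ z with z m = k, (g (pairOf n m) (extend n (v.1 n) z) +
        if m.1 < n ∧ extend n (v.1 n) z = v.1 then 1 else 0) *
      W (extend n (v.1 n) z, v.2) (π (extend n (v.1 n) z) (pairOf n m), t) +
      s (pairKey n m (v.1 n) k, t) = _
  have h1 := sum_extend n (v.1 n) (fun z => z m = k) (fun x => x n = v.1 n ∧ x m.1 = k)
    (fun z => by rw [extend_self, extend_apply_of_ne]; simp)
    (fun _ hx => hx.1)
    (fun x => (g (pairOf n m) x + if m.1 < n ∧ x = v.1 then 1 else 0) *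
      W (x, v.2) (π x (pairOf n m), t))
  rw [h1, dapacMask]
  simp only [pairKey_spec]
  change _ = s (pairKey n m (v.1 n) k, t) + (∑ x with x n = v.1 n ∧ x m.1 = k,
    g (pairOf n m) x * W (x, v.2) (π x (pairOf n m), t)) +
    if m.1 < n ∧ v.1 m.1 = k then W v (π v.1 (pairOf n m), t) else 0
  simp only [add_mul, ite_mul, one_mul, zero_mul, Finset.sum_add_distrib]
  have h2 : ∑ x with x n = v.1 n ∧ x m.1 = k,
      (if m.1 < n ∧ x = v.1 then W (x, v.2) (π x (pairOf n m), t) else 0) =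
      if m.1 < n ∧ v.1 m.1 = k then W v (π v.1 (pairOf n m), t) else 0 := by
    by_cases hm : m.1 < n
    · simp only [hm, true_and]
      rw [Finset.sum_ite_eq' _ v.1 (fun x => W (x, v.2) (π x (pairOf n m), t))]
      simp
    · simp [hm]
  rw [h2]
  ring

theorem dapac_pointwiseFeasible (a : ℕ) : (dapacScheme N D K F a).PointwiseFeasible where
  decodable := by
    intro v ω ω' hq ha
    funext ⟨i, t⟩
    obtain ⟨⟨⟨n, m⟩, hnm⟩, hp⟩ : ∃ p, ω.1.1 v.1 p = i := (ω.1.1 v.1).surjective i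
    -- The designated sub-packet is the difference of the answers of the two servers.
    have key : ∀ ω : (dapacScheme N D K F a).Omega,
        ω.2.1 v (ω.1.1 v.1 ⟨(n, m), hnm⟩, t) =
          (dapacScheme N D K F a).aD v m ω (⟨n, hnm.ne⟩, v.1 n, t) -
          (dapacScheme N D K F a).aD v n ω (⟨m, hnm.ne'⟩, v.1 m, t) := by
      intro ω
      have e1 : pairOf n ⟨m, hnm.ne'⟩ = ⟨(n, m), hnm⟩ := by simp only [pairOf]; exact dif_pos hnm
      have e2 : pairOf m ⟨n, hnm.ne⟩ = ⟨(n, m), hnm⟩ := by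
        simp only [pairOf]; exact dif_neg hnm.asymm
      rw [dapac_aD_eq, dapac_aD_eq]
      simp only [pairKey, e1, e2]
      rw [if_pos hnm, if_neg (show ¬ m < n from hnm.asymm), if_pos ⟨hnm, trivial⟩,
        if_neg fun h => hnm.asymm h.1]
      ring
    have hπ : ω.1.1 v.1 ⟨(n, m), hnm⟩ = ω'.1.1 v.1 ⟨(n, m), hnm⟩ := by
      have h := congrArg (fun q => (q.1 n ⟨m, hnm.ne'⟩).2 (others n v.1)) hq
      change ω.1.1 (extend n (v.1 n) (others n v.1)) (pairOf n ⟨m, hnm.ne'⟩) =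
        ω'.1.1 (extend n (v.1 n) (others n v.1)) (pairOf n ⟨m, hnm.ne'⟩) at h
      rw [extend_others, pairOf, dif_pos hnm] at h
      exact h
    have hn : ∀ n, (dapacScheme N D K F a).aD v n ω = (dapacScheme N D K F a).aD v n ω' :=
      fun n => congrArg (fun a => a.1 n) ha
    change ω.2.1 v (i, t) = ω'.2.1 v (i, t)
    have h1 := key ω
    have h2 := key ω'
    rw [hp] at h1
    rw [← hπ, hp] at h2
    rw [h1, h2, hn, hn]
  masked := by
    intro v
    refine ⟨fun u W r => ∑ x with x r.1.1.1.1 = r.1.2.1 ∧ x r.1.1.1.2 = r.1.2.2,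
        u.2 r.1.1 x * W (x, v.2) (u.1 x r.1.1, r.2),
      fun u w r => (fun n j => r (pairKey n j.1 (v.1 n) j.2.1, j.2.2) +
        if j.1.1 < n ∧ v.1 j.1.1 = j.2.1 then w (u.1 v.1 (pairOf n j.1), j.2.2) else 0,
        fun e => e.elim), ?_⟩
    intro u W s
    exact Prod.ext (funext fun n => funext fun j => dapac_aD_eq v (u, W, s) n j.1 j.2.1 j.2.2)
      (funext fun e => e.elim)
  privateD := by
    intro n
    refine ⟨fun v => (Equiv.refl _).prodCongr
        (Equiv.addRight fun p x => if p.1.2 = n ∧ x = v.1 then 1 else 0),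
      fun k _ u m => (fun z => u.2 (pairOf n m) (extend n k z),
        fun z => u.1 (extend n k z) (pairOf n m)), ?_⟩
    -- The law of the private randomness is uniform, hence invariant under every permutation.
    refine fun v u => ⟨rfl, funext fun m => Prod.ext (funext fun z => ?_) rfl⟩
    change _ = u.2 (pairOf n m) (extend n (v.1 n) z) +
      if (pairOf n m).1.2 = n ∧ extend n (v.1 n) z = v.1 then 1 else 0
    simp only [pairOf_snd_eq_iff]
    rfl
  privateC := ⟨fun _ _ => (), fun _ _ => rfl⟩

end Dapac

theorem sharedScheme_feasible {N D K : ℕ} {F : Type} [Field F] [Fintype F] (a b : ℕ)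
    (pX : Fin D → stdSimplex ℝ (Fin K)) (pY : Fin (N - D) → stdSimplex ℝ (Fin K))
    (pW : Attr N D K → stdSimplex ℝ (ServerPair D × Fin a ⊕ Fin D × Fin b → F)) :
    (sharedScheme N D K F a b).Feasible pX pY pW :=
  ((dapac_pointwiseFeasible a).timeShare (scheme1_pointwiseFeasible b)).feasible pX pY pW

/-! ### Download costs -/

section Costs

theorem card_serverPair (D : ℕ) : Fintype.card (ServerPair D) = D.choose 2 := by
  let e : ServerPair D ≃ Σ j : Fin D, {i : Fin D // i < j} :=
    { toFun := fun p => ⟨p.1.2, p.1.1, p.2⟩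
      invFun := fun q => ⟨(q.2.1, q.1), q.2.2⟩
      left_inv := fun _ => rfl
      right_inv := fun _ => rfl }
  rw [Fintype.card_congr e, Fintype.card_sigma, Nat.choose_two_right, ← Finset.sum_range_id,
    ← Fin.sum_univ_eq_sum_range fun i => i]
  refine Finset.sum_congr rfl fun j _ => ?_
  rw [Fintype.card_subtype, Finset.filter_gt_eq_Iio, Fin.card_Iio]

variable {N D K : ℕ} {F : Type} [Field F] [Fintype F] (a b : ℕ)

theorem card_message :
    Fintype.card (ServerPair D × Fin a ⊕ Fin D × Fin b) = D.choose 2 * a + D * b := by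
  simp only [Fintype.card_sum, Fintype.card_prod, card_serverPair, Fintype.card_fin]

theorem card_sharedScheme_ansD (n : Fin D) :
    Fintype.card ((sharedScheme N D K F a b).AnsD n) = (D - 1) * (K * a) + b := by
  change Fintype.card ({m : Fin D // m ≠ n} × Fin K × Fin a ⊕ Fin b) = _
  simp

theorem card_sharedScheme_ansC :
    Fintype.card (sharedScheme N D K F a b).AnsC = D * (K * b) := by
  change Fintype.card (Empty ⊕ Fin D × Fin K × Fin b) = _
  simp

theorem sharedScheme_symmetric : (sharedScheme N D K F a b).Symmetric := fun n m => by
  rw [card_sharedScheme_ansD, card_sharedScheme_ansD]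

variable {a b}

theorem messageLength_pos (hD : 2 ≤ D) (hab : 0 < a + b) :
    0 < (D.choose 2 * a : ℝ) + D * b := by
  have h2 : 0 < D.choose 2 := Nat.choose_pos hD
  have : 0 < D.choose 2 * a + D * b := by
    rcases Nat.eq_zero_or_pos a with rfl | ha
    · have : 0 < D * b := Nat.mul_pos (by omega) (by omega)
      omega
    · have := Nat.mul_pos h2 ha
      omega
  exact_mod_cast this

theorem sharedScheme_rate (hD : 2 ≤ D) (hK : 1 ≤ K) (hab : 0 < a + b) :
    (sharedScheme N D K F a b).rate =
      tsRate K ((D.choose 2 * a : ℝ) / (D.choose 2 * a + D * b)) := by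
  have hL := messageLength_pos hD hab
  have hD1 : ((D - 1 : ℕ) : ℝ) = D - 1 := by rw [Nat.cast_sub (by omega), Nat.cast_one]
  have hK' : (1 : ℝ) ≤ K := by exact_mod_cast hK
  have ha : (0 : ℝ) ≤ D.choose 2 * a := by positivity
  have hb : (0 : ℝ) ≤ D * b := by positivity
  rw [Scheme.rate, card_message, card_sharedScheme_ansC]
  simp only [card_sharedScheme_ansD, Finset.sum_const, Finset.card_univ, Fintype.card_fin,
    nsmul_eq_mul]
  push_cast
  rw [hD1, tsRate]
  have h1 : (D.choose 2 : ℝ) * a + D * b ≠ 0 := hL.ne'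
  have hden : (K : ℝ) * (1 + D.choose 2 * a / (D.choose 2 * a + D * b)) +
      (1 - D.choose 2 * a / (D.choose 2 * a + D * b)) =
      (D * ((D - 1) * (K * a) + b) + D * (K * b)) / (D.choose 2 * a + D * b) := by
    field_simp
    rw [Nat.cast_choose_two]
    ring
  rw [hden, one_div_div]

theorem sharedScheme_hasLoadRatio (hD : 2 ≤ D) (hK : 1 ≤ K) (hab : 0 < a + b) :
    (sharedScheme N D K F a b).HasLoadRatio
      (tsLoad D K ((D.choose 2 * a : ℝ) / (D.choose 2 * a + D * b))) := by
  intro n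
  have hL := messageLength_pos hD hab
  have h1 : (D.choose 2 : ℝ) * a + D * b ≠ 0 := hL.ne'
  have hD0 : (0 : ℝ) < D := by positivity
  have hD1 : ((D - 1 : ℕ) : ℝ) = D - 1 := by rw [Nat.cast_sub (by omega), Nat.cast_one]
  -- Numerator and denominator of the load ratio are the download costs times a common factor.
  have hc : 0 < (D : ℝ) / (D.choose 2 * a + D * b) := div_pos hD0 hL
  rw [card_sharedScheme_ansD, card_sharedScheme_ansC, tsLoad]
  have hn : 2 * (K : ℝ) * (D.choose 2 * a / (D.choose 2 * a + D * b)) + 1 -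
      D.choose 2 * a / (D.choose 2 * a + D * b) =
      (D / (D.choose 2 * a + D * b)) * (((D - 1) * (K * a) + b : ℕ) : ℝ) := by
    push_cast
    rw [hD1]
    field_simp
    rw [Nat.cast_choose_two]
    ring
  have hd : (K : ℝ) * D * (1 - D.choose 2 * a / (D.choose 2 * a + D * b)) =
      (D / (D.choose 2 * a + D * b)) * ((D * (K * b) : ℕ) : ℝ) := by
    push_cast
    field_simp
    ring
  rw [hn, hd, ENNReal.ofReal_mul hc.le, ENNReal.ofReal_mul hc.le, ENNReal.ofReal_natCast,
    ENNReal.ofReal_natCast, ENNReal.mul_div_mul_left _ _ (by simpa using hc) ENNReal.ofReal_ne_top]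

end Costs

/-! ### Attained pairs -/

section Attained

variable {N D K : ℕ} {F : Type} [Field F] [Fintype F]

theorem attained_of_rat (hD : 2 ≤ D) (hK : 1 ≤ K) (lam : ℚ) (h0 : 0 ≤ lam) (h1 : lam ≤ 1) :
    (tsRate K lam, tsLoad D K lam) ∈ Attained N D K F := by
  have hden : 0 < lam.den := lam.den_pos
  obtain ⟨p, hp⟩ : ∃ p : ℕ, lam.num = p := Int.eq_ofNat_of_zero_le (Rat.num_nonneg.mpr h0)
  have hlam : lam = p / lam.den := by
    conv_lhs => rw [← Rat.num_div_den lam, hp]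
    simp
  have hle : p ≤ lam.den := by
    have h2 : (lam.den : ℚ) > 0 := by exact_mod_cast hden
    rw [hlam, div_le_one h2] at h1
    exact_mod_cast h1
  -- The lengths `(D choose 2) a` and `D b` are in the ratio `p : (lam.den - p)`.
  have hab : 0 < 2 * p + (D - 1) * (lam.den - p) := by
    rcases Nat.eq_zero_or_pos p with h | h
    · have : 0 < (D - 1) * (lam.den - p) := Nat.mul_pos (by omega) (by omega)
      omega
    · omega
  have hval : (lam : ℝ) = (D.choose 2 * (2 * p : ℕ) : ℝ) /
      (D.choose 2 * (2 * p : ℕ) + D * ((D - 1) * (lam.den - p) : ℕ)) := by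
    have hD' : (2 : ℝ) ≤ D := by exact_mod_cast hD
    have hd : (0 : ℝ) < lam.den := by exact_mod_cast hden
    have hlam' : (lam : ℝ) = p / lam.den := by
      conv_lhs => rw [hlam]
      push_cast
      rfl
    have hD0 : (D : ℝ) ≠ 0 := by positivity
    have hD1 : (D : ℝ) - 1 ≠ 0 := by linarith
    rw [hlam', Nat.cast_mul (D - 1), Nat.cast_sub hle, Nat.cast_sub (by omega : 1 ≤ D),
      Nat.cast_choose_two]
    push_cast
    have : (D : ℝ) * (D - 1) / 2 * (2 * p) + D * ((D - 1) * (lam.den - p)) =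
        D * (D - 1) * lam.den := by ring
    rw [this]
    field_simp
  refine ⟨2 * p, (D - 1) * (lam.den - p), ?_, sharedScheme_feasible _ _,
    sharedScheme_symmetric _ _, ?_, ?_⟩
  · rw [card_message]
    exact_mod_cast messageLength_pos hD hab
  · rw [sharedScheme_rate hD hK hab, ← hval]
  · rw [hval]
    exact sharedScheme_hasLoadRatio hD hK hab

theorem continuousAt_tsRate (hK : 1 ≤ K) {lam : ℝ} (h0 : 0 ≤ lam) :
    ContinuousAt (tsRate K) lam := by
  unfold tsRate
  have hK' : (1 : ℝ) ≤ K := by exact_mod_cast hK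
  refine ContinuousAt.div (by fun_prop) (by fun_prop) ?_
  nlinarith [mul_nonneg (sub_nonneg.mpr hK') h0]

theorem tsLoad_num_pos (hK : 1 ≤ K) {lam : ℝ} (h0 : 0 ≤ lam) :
    0 < 2 * (K : ℝ) * lam + 1 - lam := by
  have hK' : (1 : ℝ) ≤ K := by exact_mod_cast hK
  nlinarith [mul_nonneg (sub_nonneg.mpr hK') h0]

theorem continuousAt_tsLoad (hK : 1 ≤ K) {lam : ℝ} (h0 : 0 ≤ lam) :
    ContinuousAt (tsLoad D K) lam := by
  unfold tsLoad
  refine ENNReal.Tendsto.div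
    (ENNReal.continuous_ofReal.continuousAt.comp
      (f := fun lam : ℝ => 2 * K * lam + 1 - lam) (by fun_prop)) (Or.inl ?_)
    (ENNReal.continuous_ofReal.continuousAt.comp
      (f := fun lam : ℝ => K * D * (1 - lam)) (by fun_prop)) (Or.inl ENNReal.ofReal_ne_top)
  simpa using tsLoad_num_pos hK h0

theorem mem_closure_attained (hD : 2 ≤ D) (hK : 1 ≤ K) {lam : ℝ} (h0 : 0 ≤ lam) (h1 : lam ≤ 1) :
    (tsRate K lam, tsLoad D K lam) ∈ closure (Attained N D K F) := by
  -- Approximate `lam` by the rationals `⌊lam * n⌋ / n`, which lie in `[0, 1]`.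
  have hlim : Filter.Tendsto (fun n : ℕ => (⌊lam * n⌋₊ : ℝ) / n) Filter.atTop (nhds lam) :=
    (tendsto_nat_floor_mul_div_atTop h0).comp tendsto_natCast_atTop_atTop
  refine mem_closure_of_tendsto (((continuousAt_tsRate hK h0).tendsto.comp hlim).prodMk_nhds
    ((continuousAt_tsLoad hK h0).tendsto.comp hlim)) (Filter.Eventually.of_forall fun n => ?_)
  have hle : ((⌊lam * n⌋₊ : ℚ) / n) ≤ 1 := by
    refine div_le_one_of_le₀ ?_ (by positivity)
    exact_mod_cast Nat.floor_le_of_le (mul_le_of_le_one_left (Nat.cast_nonneg n) h1)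
  have h := attained_of_rat (N := N) (F := F) hD hK ((⌊lam * n⌋₊ : ℚ) / n) (by positivity) hle
  push_cast at h
  exact h

end Attained

/-! ### The trade-off curve -/

section Tradeoff

variable {D K : ℕ}

theorem tsLoad_eq_ofReal (hD : 2 ≤ D) (hK : 1 ≤ K) {lam : ℝ} (h1 : lam < 1) :
    tsLoad D K lam = ENNReal.ofReal ((2 * K * lam + 1 - lam) / (K * D * (1 - lam))) := by
  have : 0 < (K : ℝ) * D * (1 - lam) := by
    have : (0 : ℝ) < 1 - lam := by linarith
    positivity
  rw [tsLoad, ENNReal.ofReal_div_of_pos this]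

theorem tsRate_eq_tradeoff (hD : 2 ≤ D) (hK : 1 ≤ K) {lam : ℝ} (h1 : lam < 1) :
    tsRate K lam = tradeoff D K ((2 * K * lam + 1 - lam) / (K * D * (1 - lam))) := by
  have hK0 : (0 : ℝ) < K := by positivity
  have hD0 : (0 : ℝ) < D := by positivity
  have hl : (1 : ℝ) - lam ≠ 0 := by linarith
  have hden : (2 * (K : ℝ) * lam + 1 - lam) / (K * D * (1 - lam)) * K * D + 2 * K - 1 =
      2 * K / (1 - lam) := by
    field_simp
    ring
  rw [tradeoff, tsRate, hden]
  congr 1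
  field_simp
  ring

theorem tsLoad_ne_top (hD : 2 ≤ D) (hK : 1 ≤ K) {lam : ℝ} (h1 : lam < 1) :
    tsLoad D K lam ≠ ⊤ := by
  rw [tsLoad_eq_ofReal hD hK h1]
  exact ENNReal.ofReal_ne_top

theorem toReal_tsLoad (hD : 2 ≤ D) (hK : 1 ≤ K) {lam : ℝ} (h0 : 0 ≤ lam) (h1 : lam < 1) :
    (tsLoad D K lam).toReal = (2 * K * lam + 1 - lam) / (K * D * (1 - lam)) := by
  have h2 : (0 : ℝ) ≤ 1 - lam := by linarith
  rw [tsLoad_eq_ofReal hD hK h1,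
    ENNReal.toReal_ofReal (div_nonneg (tsLoad_num_pos hK h0).le (by positivity))]

theorem tsRate_one : tsRate K 1 = 1 / (2 * K) := by
  rw [tsRate]
  congr 1
  ring

theorem tsLoad_one (hK : 1 ≤ K) : tsLoad D K 1 = ⊤ := by
  have h : (2 * K : ℝ≥0∞) ≠ 0 := by simp; omega
  simp [tsLoad, ENNReal.div_zero h]

theorem tsRate_zero : tsRate K 0 = 1 / (K + 1) := by
  simp [tsRate]

theorem tsLoad_zero : tsLoad D K 0 = 1 / (K * D) := by
  rw [tsLoad, mul_zero, zero_add, sub_zero, mul_one, ENNReal.ofReal_one,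
    ENNReal.ofReal_mul (Nat.cast_nonneg K), ENNReal.ofReal_natCast, ENNReal.ofReal_natCast]

theorem image_tsRate_tsLoad (hD : 2 ≤ D) (hK : 1 ≤ K) :
    (fun lam : ℝ => (tsRate K lam, tsLoad D K lam)) '' Set.Icc 0 1 =
      insert ((1 : ℝ) / (2 * K), (⊤ : ENNReal))
        ((fun l : ℝ => (tradeoff D K l, ENNReal.ofReal l)) '' Set.Ici ((1 : ℝ) / (K * D))) := by
  have hK1 : (1 : ℝ) ≤ K := by exact_mod_cast hK
  have hK0 : (0 : ℝ) < K := by positivity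
  have hD0 : (0 : ℝ) < D := by positivity
  ext P
  constructor
  · rintro ⟨lam, ⟨h0, h1⟩, rfl⟩
    rcases h1.eq_or_lt with rfl | h1
    · left
      simp only [tsRate_one, tsLoad_one hK]
    · right
      refine ⟨(2 * K * lam + 1 - lam) / (K * D * (1 - lam)), ?_, ?_⟩
      · have h2 : (0 : ℝ) < 1 - lam := by linarith
        rw [Set.mem_Ici, div_le_div_iff₀ (by positivity) (by positivity)]
        have : 0 ≤ 2 * (K * D : ℝ) * K * lam := by positivity
        nlinarith
      · simp only [tsRate_eq_tradeoff hD hK h1, tsLoad_eq_ofReal hD hK h1]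
  · rintro (rfl | ⟨l, hl, rfl⟩)
    · exact ⟨1, by simp, by simp only [tsRate_one, tsLoad_one hK]⟩
    · rw [Set.mem_Ici, div_le_iff₀ (by positivity)] at hl
      have hden : (0 : ℝ) < l * (K * D) + 2 * K - 1 := by linarith
      -- The load ratio as a function of `lam` is inverted by solving a linear equation.
      have h0 : 0 ≤ (l * (K * D) - 1) / (l * (K * D) + 2 * K - 1) :=
        div_nonneg (by linarith) hden.le
      have h1 : (l * (K * D) - 1) / (l * (K * D) + 2 * K - 1) < 1 := by
        rw [div_lt_one hden]
        linarith
      have hinv : (2 * K * ((l * (K * D) - 1) / (l * (K * D) + 2 * K - 1)) + 1 -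
          (l * (K * D) - 1) / (l * (K * D) + 2 * K - 1)) /
          (K * D * (1 - (l * (K * D) - 1) / (l * (K * D) + 2 * K - 1))) = l := by
        have hs : 1 - (l * (K * D) - 1) / (l * (K * D) + 2 * K - 1) =
            2 * K / (l * (K * D) + 2 * K - 1) := by
          rw [eq_div_iff hden.ne', sub_mul, div_mul_cancel₀ _ hden.ne']
          ring
        have hn : ∀ t : ℝ, 2 * K * t + 1 - t = 2 * K * t + (1 - t) := fun t => by ring
        rw [hn, hs, div_eq_iff (by positivity)]
        ring
      refine ⟨(l * (K * D) - 1) / (l * (K * D) + 2 * K - 1), ⟨h0, h1.le⟩, ?_⟩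
      simp only [tsRate_eq_tradeoff hD hK h1, tsLoad_eq_ofReal hD hK h1, hinv]

theorem tendsto_tradeoff (hD : 2 ≤ D) (hK : 1 ≤ K) :
    Filter.Tendsto (tradeoff D K) Filter.atTop (nhds ((1 : ℝ) / (2 * K))) := by
  have hK1 : (1 : ℝ) ≤ K := by exact_mod_cast hK
  have hK0 : (0 : ℝ) < K := by positivity
  have hD0 : (0 : ℝ) < D := by positivity
  have hatTop : Filter.Tendsto (fun l : ℝ => l * K * D + 2 * K - 1) Filter.atTop Filter.atTop := by
    have h := Filter.tendsto_atTop_add_const_right Filter.atTop (2 * (K : ℝ) - 1)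
      ((Filter.tendsto_id (α := ℝ)).atTop_mul_const (mul_pos hK0 hD0))
    refine h.congr fun l => ?_
    simp only [id]
    ring
  -- The fraction in the trade-off function is `K` plus a constant over its denominator.
  have hfrac : Filter.Tendsto (fun l : ℝ => (K : ℝ) + (K + (2 * K - 2 * K ^ 2) /
      (l * K * D + 2 * K - 1))) Filter.atTop (nhds ((K : ℝ) + ((K : ℝ) + 0))) :=
    ((hatTop.const_div_atTop _).const_add _).const_add _
  have h := (tendsto_const_nhds (x := (1 : ℝ))).div hfrac (by positivity)
  rw [add_zero, ← two_mul] at h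
  refine h.congr' ?_
  filter_upwards [hatTop.eventually_gt_atTop 0] with l hl
  simp only [tradeoff, Pi.div_apply]
  congr 2
  rw [eq_div_iff hl.ne', add_mul, div_mul_cancel₀ _ hl.ne']
  ring

end Tradeoff

end HetDAPAC

theorem mainTheorem3 (F : Type) [Field F] [Fintype F] (N D K : ℕ)
    (hD : 2 ≤ D) (hDN : D ≤ N) (hK : 1 ≤ K) :
    -- every time-sharing scheme is feasible, with the pair determined by the DAPAC fraction `lam`
    (∀ a b : ℕ, 0 < a + b → ∀ lam : ℝ,
      lam = (D.choose 2 * a : ℝ) / (D.choose 2 * a + D * b : ℝ) →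
      (∀ pX pY pW, (HetDAPAC.sharedScheme N D K F a b).Feasible pX pY pW) ∧
      (HetDAPAC.sharedScheme N D K F a b).Symmetric ∧
      (HetDAPAC.sharedScheme N D K F a b).rate = HetDAPAC.tsRate K lam ∧
      (HetDAPAC.sharedScheme N D K F a b).HasLoadRatio (HetDAPAC.tsLoad D K lam)) ∧
    -- exact achievability for rational `lam`, achievability in the limit for all `lam`
    (∀ lam : ℚ, 0 ≤ lam → lam ≤ 1 →
      (HetDAPAC.tsRate K lam, HetDAPAC.tsLoad D K lam) ∈ HetDAPAC.Attained N D K F) ∧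
    (∀ lam : ℝ, 0 ≤ lam → lam ≤ 1 →
      (HetDAPAC.tsRate K lam, HetDAPAC.tsLoad D K lam) ∈
        closure (HetDAPAC.Attained N D K F)) ∧
    -- the end points
    (HetDAPAC.tsRate K 0, HetDAPAC.tsLoad D K 0) =
      ((1 : ℝ) / (K + 1), (1 : ENNReal) / (K * D)) ∧
    (HetDAPAC.tsRate K 1, HetDAPAC.tsLoad D K 1) = ((1 : ℝ) / (2 * K), (⊤ : ENNReal)) ∧
    -- the pairs are exactly those on the trade-off curve, from one end point to the other
    (∀ lam : ℝ, 0 ≤ lam → lam < 1 → HetDAPAC.tsLoad D K lam ≠ ⊤ ∧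
      HetDAPAC.tsRate K lam = HetDAPAC.tradeoff D K (HetDAPAC.tsLoad D K lam).toReal) ∧
    (fun lam : ℝ => (HetDAPAC.tsRate K lam, HetDAPAC.tsLoad D K lam)) '' Set.Icc 0 1 =
      insert ((1 : ℝ) / (2 * K), (⊤ : ENNReal))
        ((fun l : ℝ => (HetDAPAC.tradeoff D K l, ENNReal.ofReal l)) ''
          Set.Ici ((1 : ℝ) / (K * D))) ∧
    Filter.Tendsto (HetDAPAC.tradeoff D K) Filter.atTop (nhds ((1 : ℝ) / (2 * K))) := by
  refine ⟨?_, HetDAPAC.attained_of_rat hD hK, fun lam => HetDAPAC.mem_closure_attained hD hK,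
    Prod.ext HetDAPAC.tsRate_zero HetDAPAC.tsLoad_zero,
    Prod.ext HetDAPAC.tsRate_one (HetDAPAC.tsLoad_one hK), ?_,
    HetDAPAC.image_tsRate_tsLoad hD hK, HetDAPAC.tendsto_tradeoff hD hK⟩
  · rintro a b hab lam rfl
    exact ⟨HetDAPAC.sharedScheme_feasible a b, HetDAPAC.sharedScheme_symmetric a b,
      HetDAPAC.sharedScheme_rate hD hK hab, HetDAPAC.sharedScheme_hasLoadRatio hD hK hab⟩
  · intro lam h0 h1
    refine ⟨HetDAPAC.tsLoad_ne_top hD hK h1, ?_⟩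
    rw [HetDAPAC.toReal_tsLoad hD hK h0 h1, HetDAPAC.tsRate_eq_tradeoff hD hK h1]
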